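/- Let $I=[0,1]$ with Lebesgue measure $\mu$. An isomorphism mod 0 of measure spaces is a measure-preserving map $T$ for which there is a measure-preserving map $S$ in the opposite direction with $ST=\mathrm{id}$ and $TS=\mathrm{id}$ almost everywhere. A function $f:I\times I\to\mathbb R$ is called pure if there are sets $A,B\subset I$ of full measure such that for $x\ne x'$ in $A$ the functions $f(x,\cdot)$ and $f(x',\cdot)$ are not equal almost everywhere, and for $y\neq y'$ in $B$ the functions $f(\cdot,y)$ and $f(\cdot,y')$ are not equal almost everywhere. Two functions $f_1,f_2$ on $I\times I$ are called isomorphic if there are isomorphisms mod 0 $T_1,T_2$ of $(I,\mu)$ onto itself with $f_2(T_1x,T_2y)=f_1(x,y)$ for almost all $(x,y)$. The matrix distribution $D_f$ of $f$ is the law of the random matrix $\bigl(f(x_n,y_m)\bigr)_{(n,m)\in\mathbb Z^2}$, a measure on $\mathbb R^{\mathbb Z\times\mathbb Z}$, where $(x_n)_{n\in\mathbb Z}$ and $(y_m)_{m\in\mathbb Z}$ are two independent sequences of independent points distributed according to $\mu$. The group $\mathbb Z^2$ acts on $\mathbb R^{\mathbb Z\times\mathbb Z}$ by the translations of rows and columns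 $(\tau_{k,l}M)_{n,m}=M_{n+k,m+l}$. **Lemma.** For every pure integrable function $f$ on $I\times I$, the matrix distribution $D_f$ is a probability measure invariant under the translations $\tau_{k,l}$, and, regarded as a measure acted upon by $\mathbb Z^2$, it is a complete system of isomorphism invariants of $f$. That is, for any two pure integrable functions $f_1,f_2$ on $I\times I$ the following conditions are equivalent: 1. $f_1$ and $f_2$ are isomorphic; 2. $D_{f_1}=D_{f_2}$ as measures on the space of matrices acted upon by $\mathbb Z^2$; 3. there is an isomorphism mod 0 $\Phi$ of $(\mathbb R^{\mathbb Z\times\mathbb Z},D_{f_1})$ onto $(\mathbb R^{\mathbb Z\times\mathbb Z},D_{f_2})$ such that for all $(k,l)\in\mathbb Z^2$ one has $\Phi(\tau_{k,l}M)=\tau_{k,l}\Phi(M)$ for $D_{f_1}$-almost every $M$, and $\Phi(M)_{0,0}=M_{0,0}$ for $D_{f_1}$-almost every $M$. -/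

import Mathlib

open MeasureTheory Filter
open scoped unitInterval

noncomputable section

namespace MatrixDistribution

/-- A function of two variables on `[0,1]²` is pure if both maps `x ↦ f(x, ·)` and `y ↦ f(·, y)`,
with values in the functions of the other variable modulo equality almost everywhere,
are one-to-one off a null set. -/
def IsPure (f : I × I → ℝ) : Prop :=
  (∃ A : Set I, (∀ᵐ x, x ∈ A) ∧
    ∀ x ∈ A, ∀ x' ∈ A, (∀ᵐ y : I, f (x, y) = f (x', y)) → x = x') ∧
  (∃ B : Set I, (∀ᵐ y, y ∈ B) ∧
    ∀ y ∈ B, ∀ y' ∈ B, (∀ᵐ x : I, f (x, y) = f (x, y')) → y = y')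

/-- `T` is an isomorphism mod 0 of the measure spaces `(α, μ)` and `(β, ν)`: a measure-preserving
map with a measure-preserving inverse, inverse to `T` almost everywhere on both sides. -/
def IsIsoMod0 {α β : Type*} [MeasurableSpace α] [MeasurableSpace β]
    (μ : Measure α) (ν : Measure β) (T : α → β) : Prop :=
  MeasurePreserving T μ ν ∧
    ∃ S : β → α, MeasurePreserving S ν μ ∧ (∀ᵐ a ∂μ, S (T a) = a) ∧ (∀ᵐ b ∂ν, T (S b) = b)

/-- Two functions of two variables on `[0,1]²` are isomorphic if the first one is obtained from
the second one by separate invertible measure-preserving changes of the two variables. -/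
def Isomorphic (f₁ f₂ : I × I → ℝ) : Prop :=
  ∃ T₁ T₂ : I → I, IsIsoMod0 volume volume T₁ ∧ IsIsoMod0 volume volume T₂ ∧
    ∀ᵐ p : I × I, f₂ (T₁ p.1, T₂ p.2) = f₁ p

/-- The Bernoulli measure on two-sided grids: two independent two-sided sequences
of independent points, uniformly distributed on `[0,1]`. -/
def gridMeasure : Measure ((ℤ → I) × (ℤ → I)) :=
  (Measure.infinitePi fun _ : ℤ => (volume : Measure I)).prod
    (Measure.infinitePi fun _ : ℤ => (volume : Measure I))

/-- The space of real matrices that are infinite in all four directions, with the product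
sigma-algebra. -/
abbrev Mat : Type := ℤ → ℤ → ℝ

/-- The restriction of `f` to the grid `({xₙ}, {yₘ})`, as an infinite matrix. -/
def gridMatrix (f : I × I → ℝ) (g : (ℤ → I) × (ℤ → I)) : Mat :=
  fun n m => f (g.1 n, g.2 m)

/-- The matrix distribution `D_f` of `f`: the law of the random matrix `‖f(xₙ, yₘ)‖`. -/
def matrixDistribution (f : I × I → ℝ) : Measure (Mat) :=
  gridMeasure.map (gridMatrix f)

/-- The action of `ℤ²` on matrices by translations of rows and columns. -/
def translateMat (k : ℤ × ℤ) (M : Mat) : Mat :=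
  fun n m => M (n + k.1) (m + k.2)

/-- Two measures on the space of matrices are isomorphic as measures acted upon by `ℤ²` if there is
an isomorphism mod 0 between them that commutes with all translations of rows and columns and
respects the value of the matrix at the origin of the grid. -/
def TranslationIsomorphic (D₁ D₂ : Measure (Mat)) : Prop :=
  ∃ Φ : Mat → Mat, IsIsoMod0 D₁ D₂ Φ ∧
    (∀ k : ℤ × ℤ, ∀ᵐ M ∂D₁, Φ (translateMat k M) = translateMat k (Φ M)) ∧
    (∀ᵐ M ∂D₁, Φ M 0 0 = M 0 0)

end MatrixDistribution

end

/-! The substance is that one typical matrix determines `f` up to isomorphism. Split the grid into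
points with negative and nonnegative indices. The negative points `ξ` serve as reference:
integrability makes the sections of `f` along them dense in `L¹` up to null sets, so by purity `x`
is determined mod 0 by the values of `f` at `x` and the reference columns, and `y` likewise by the
reference rows (`ae_separates`). The nonnegative diagonal points are an independent i.i.d. sample of
the square, and by the strong law the matrix reveals the joint law of row values, column values and
`f` at a random point (`ae_tendsto_frequency_map`).

If the matrix distributions agree, Lusin separation provides two generic grids with literally the
same matrix (`exists_eq_of_map_eq`), hence the same joint law. Inverting the injective coordinate
maps yields `T₁` and `T₂`, and the third coordinate of the law shows that they carry `f₁` to `f₂`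
(`isomorphic_of_map_crossValues_eq`).

The converse holds because measure-preserving maps of the variables preserve the grid measure. An
equivariant `Φ` fixing the entry at the origin fixes every entry, hence is the identity a.e.; so the
third condition reduces to equality of measures. -/

namespace MatrixDistribution

open scoped ENNReal

/-! ### Splitting and reindexing i.i.d. families -/

section ProductMeasures

variable {α β X : Type*} [MeasurableSpace X] (P : Measure X) [IsProbabilityMeasure P]

theorem measurePreserving_sumElim :
    MeasurePreserving (fun (p : (α → X) × (β → X)) => (Sum.elim p.1 p.2 : α ⊕ β → X))
      ((Measure.infinitePi fun _ : α => P).prod (Measure.infinitePi fun _ : β => P))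
      (Measure.infinitePi fun _ : α ⊕ β => P) := by
  have hm : Measurable (fun (p : (α → X) × (β → X)) => (Sum.elim p.1 p.2 : α ⊕ β → X)) := by
    refine measurable_pi_iff.2 ?_
    rintro (a | b)
    · simp only [Sum.elim_inl]; fun_prop
    · simp only [Sum.elim_inr]; fun_prop
  refine ⟨hm, Measure.eq_infinitePi _ fun s t ht => ?_⟩
  rw [Measure.map_apply hm (.pi s.countable_toSet fun _ _ => ht _)]
  have : (fun (p : (α → X) × (β → X)) => (Sum.elim p.1 p.2 : α ⊕ β → X)) ⁻¹' (s : Set _).pi t =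
      ((s.toLeft : Set α).pi fun a => t (.inl a)) ×ˢ ((s.toRight : Set β).pi fun b => t (.inr b)) := by
    ext p
    simp [Set.mem_pi]
  rw [this, Measure.prod_prod, Measure.infinitePi_pi _ fun _ _ => ht _,
    Measure.infinitePi_pi _ fun _ _ => ht _]
  conv_rhs => rw [← s.toLeft_disjSum_toRight, Finset.prod_disjSum]

theorem measurePreserving_sumRestrict :
    MeasurePreserving (fun (ω : α ⊕ β → X) => (fun a => ω (.inl a), fun b => ω (.inr b)))
      (Measure.infinitePi fun _ : α ⊕ β => P)
      ((Measure.infinitePi fun _ : α => P).prod (Measure.infinitePi fun _ : β => P)) := by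
  refine ⟨by fun_prop, ?_⟩
  rw [← (measurePreserving_sumElim (α := α) (β := β) P).map_eq,
    Measure.map_map (by fun_prop) (measurePreserving_sumElim P).measurable]
  exact Measure.map_id

theorem measurePreserving_reindex {e : α → β} (he : Function.Injective e) :
    MeasurePreserving (fun (ω : β → X) a => ω (e a))
      (Measure.infinitePi fun _ : β => P) (Measure.infinitePi fun _ : α => P) :=
  ⟨by fun_prop, Measure.map_infinitePi_infinitePi_of_inj he⟩

theorem measurePreserving_pairs :
    MeasurePreserving (fun (ω : α × Fin 2 → X) a => (ω (a, 0), ω (a, 1)))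
      (Measure.infinitePi fun _ : α × Fin 2 => P) (Measure.infinitePi fun _ : α => P.prod P) := by
  have h1 : MeasurePreserving (MeasurableEquiv.curry α (Fin 2) X)
      (Measure.infinitePi fun _ : α × Fin 2 => P)
      (Measure.infinitePi fun _ : α => Measure.infinitePi fun _ : Fin 2 => P) :=
    ⟨by fun_prop, Measure.infinitePi_map_curry fun _ _ => P⟩
  have h2 : MeasurePreserving (fun (ω : α → Fin 2 → X) a => (ω a 0, ω a 1))
      (Measure.infinitePi fun _ : α => Measure.infinitePi fun _ : Fin 2 => P)
      (Measure.infinitePi fun _ : α => P.prod P) := by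
    refine ⟨by fun_prop, ?_⟩
    have := Measure.infinitePi_map_pi (fun _ : α => Measure.infinitePi fun _ : Fin 2 => P)
      (f := fun _ ω => (ω 0, ω 1)) (fun _ => by fun_prop)
    rw [this]
    congr 1
    funext _
    exact Measure.infinitePi_map_eval_prod (P := fun _ : Fin 2 => P) (by decide)
  exact h2.comp h1

end ProductMeasures

/-! ### The random grid and its symmetries -/

instance : IsProbabilityMeasure gridMeasure := by unfold gridMeasure; infer_instance

/-- The points of the grid with negative indices form an i.i.d. sequence independent
of the i.i.d. sequence of the points with nonnegative indices. -/
theorem measurePreserving_gridSplit :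
    MeasurePreserving
      (fun g : (ℤ → I) × (ℤ → I) =>
        ((fun k : ℕ => (g.1 (Int.negSucc k), g.2 (Int.negSucc k))),
          (fun k : ℕ => (g.1 (Int.ofNat k), g.2 (Int.ofNat k)))))
      gridMeasure
      ((Measure.infinitePi fun _ : ℕ => (volume : Measure I).prod volume).prod
        (Measure.infinitePi fun _ : ℕ => (volume : Measure I).prod volume)) := by
  -- Both coordinate sequences form a single i.i.d. family over `ℤ ⊕ ℤ`; independence of the two
  -- halves then amounts to injectivity of this reindexing.
  let e : (ℕ × Fin 2) ⊕ (ℕ × Fin 2) → ℤ ⊕ ℤ :=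
    Sum.elim (fun p => if p.2 = 0 then .inl (Int.negSucc p.1) else .inr (Int.negSucc p.1))
      (fun p => if p.2 = 0 then .inl (Int.ofNat p.1) else .inr (Int.ofNat p.1))
  have he : Function.Injective e := by
    rintro (⟨a, i⟩ | ⟨a, i⟩) (⟨b, j⟩ | ⟨b, j⟩) <;> fin_cases i <;> fin_cases j <;> simp [e]
  have h := ((measurePreserving_pairs (α := ℕ) (volume : Measure I)).prod
    (measurePreserving_pairs (α := ℕ) (volume : Measure I))).comp
    ((measurePreserving_sumRestrict (volume : Measure I)).comp
      ((measurePreserving_reindex volume he).comp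
        (measurePreserving_sumElim (α := ℤ) (β := ℤ) (volume : Measure I))))
  exact h

theorem measurePreserving_gridEval (n m : ℤ) :
    MeasurePreserving (fun g : (ℤ → I) × (ℤ → I) => (g.1 n, g.2 m)) gridMeasure volume :=
  (measurePreserving_eval_infinitePi (fun _ : ℤ => (volume : Measure I)) n).prod
    (measurePreserving_eval_infinitePi (fun _ : ℤ => (volume : Measure I)) m)

theorem measurePreserving_gridTranslate (k : ℤ × ℤ) :
    MeasurePreserving
      (fun g : (ℤ → I) × (ℤ → I) => ((fun n => g.1 (n + k.1)), (fun m => g.2 (m + k.2))))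
      gridMeasure gridMeasure :=
  (measurePreserving_reindex (volume : Measure I) (add_left_injective k.1)).prod
    (measurePreserving_reindex (volume : Measure I) (add_left_injective k.2))

theorem measurePreserving_gridMap {T₁ T₂ : I → I} (h₁ : MeasurePreserving T₁)
    (h₂ : MeasurePreserving T₂) :
    MeasurePreserving
      (fun g : (ℤ → I) × (ℤ → I) => ((fun n => T₁ (g.1 n)), (fun m => T₂ (g.2 m))))
      gridMeasure gridMeasure := by
  have key {T : I → I} (h : MeasurePreserving T) :
      MeasurePreserving (fun (x : ℤ → I) n => T (x n))
        (Measure.infinitePi fun _ : ℤ => (volume : Measure I))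
        (Measure.infinitePi fun _ : ℤ => (volume : Measure I)) := by
    have := h.measurable
    refine ⟨by fun_prop, ?_⟩
    rw [Measure.infinitePi_map_pi (fun _ : ℤ => (volume : Measure I)) (f := fun _ => T)
      (fun _ => h.measurable), h.map_eq]
  exact (key h₁).prod (key h₂)

theorem gridMatrix_ae_eq {f g : I × I → ℝ} (h : f =ᵐ[volume] g) :
    gridMatrix f =ᵐ[gridMeasure] gridMatrix g := by
  have : ∀ᵐ p ∂gridMeasure, ∀ n m : ℤ, f (p.1 n, p.2 m) = g (p.1 n, p.2 m) := by
    refine ae_all_iff.2 fun n => ae_all_iff.2 fun m => ?_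
    exact (measurePreserving_gridEval n m).quasiMeasurePreserving.ae h
  filter_upwards [this] with p hp
  funext n m
  exact hp n m

theorem measurable_gridMatrix {f : I × I → ℝ} (hf : Measurable f) : Measurable (gridMatrix f) := by
  unfold gridMatrix
  fun_prop

theorem matrixDistribution_congr {f g : I × I → ℝ} (h : f =ᵐ[volume] g) :
    matrixDistribution f = matrixDistribution g :=
  Measure.map_congr (gridMatrix_ae_eq h)

/-! ### Empirical frequencies -/

section Frequencies

variable {Ξ Ω E : Type*} [MeasurableSpace Ξ] [MeasurableSpace Ω] [MeasurableSpace E]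

theorem ae_tendsto_frequency (P : Measure Ω) [IsProbabilityMeasure P] {C : Set Ω}
    (hC : MeasurableSet C) :
    ∀ᵐ ω ∂(Measure.infinitePi fun _ : ℕ => P),
      Tendsto (fun N : ℕ => (∑ i ∈ Finset.range N, C.indicator (fun _ => (1 : ℝ)) (ω i)) / N)
        atTop (nhds (P.real C)) := by
  have hm : Measurable (C.indicator fun _ => (1 : ℝ)) := measurable_const.indicator hC
  have hint : Integrable (C.indicator fun _ => (1 : ℝ)) P := (integrable_const 1).indicator hC
  have hp (i : ℕ) := measurePreserving_eval_infinitePi (fun _ : ℕ => P) i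
  have h := ProbabilityTheory.strong_law_ae_real (μ := Measure.infinitePi fun _ : ℕ => P)
    (fun i ω => C.indicator (fun _ => (1 : ℝ)) (ω i)) ((hp 0).integrable_comp_of_integrable hint)
    (fun i j hij => (ProbabilityTheory.iIndepFun_infinitePi (P := fun _ : ℕ => P)
      (X := fun _ => C.indicator fun _ => (1 : ℝ)) (fun _ => hm)).indepFun hij)
    (fun i => by
      have h0 (i : ℕ) : ProbabilityTheory.IdentDistrib
          (fun ω : ℕ → Ω => C.indicator (fun _ => (1 : ℝ)) (ω i)) (C.indicator fun _ => (1 : ℝ))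
          (Measure.infinitePi fun _ : ℕ => P) P :=
        ⟨(hm.comp (measurable_pi_apply i)).aemeasurable, hm.aemeasurable, by
          conv_rhs => rw [← (hp i).map_eq]
          rw [Measure.map_map hm (by fun_prop)]
          rfl⟩
      exact (h0 i).trans (h0 0).symm)
  have hval : ∫ ω, C.indicator (fun _ => (1 : ℝ)) (ω 0) ∂(Measure.infinitePi fun _ : ℕ => P) =
      P.real C := by
    conv_rhs => rw [← integral_indicator_one hC, ← (hp 0).map_eq]
    rw [integral_map (hp 0).measurable.aemeasurable (by
      exact (measurable_const.indicator hC).aestronglyMeasurable)]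
    rfl
  rw [← hval]
  exact h

/-- A sample that never visits `C` has frequency zero, against the limit `P C`. -/
theorem ae_exists_mem (P : Measure Ω) [IsProbabilityMeasure P] {C : Set Ω}
    (hC : MeasurableSet C) (h0 : P C ≠ 0) :
    ∀ᵐ ω ∂(Measure.infinitePi fun _ : ℕ => P), ∃ k, ω k ∈ C := by
  filter_upwards [ae_tendsto_frequency P hC] with ω hω
  by_contra! hn
  have hz : (fun N : ℕ => (∑ i ∈ Finset.range N, C.indicator (fun _ => (1 : ℝ)) (ω i)) / N) =
      fun _ => 0 := by
    funext N
    rw [Finset.sum_eq_zero fun i _ => Set.indicator_of_notMem (hn i) _, zero_div]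
  rw [hz] at hω
  have := tendsto_nhds_unique hω tendsto_const_nhds
  exact h0 ((measureReal_eq_zero_iff).1 this)

/-- Almost surely, the empirical frequencies of an i.i.d. sample observed through a random map
independent of the sample converge to the conditional probabilities. -/
theorem ae_tendsto_frequency_map (Q : Measure Ξ) [SFinite Q] (P : Measure Ω)
    [IsProbabilityMeasure P] {R : Ξ × Ω → E} (hR : Measurable R) {𝒞 : Set (Set E)}
    (h𝒞 : 𝒞.Countable) (hmeas : ∀ C ∈ 𝒞, MeasurableSet C) :
    ∀ᵐ p ∂(Q.prod (Measure.infinitePi fun _ : ℕ => P)), ∀ C ∈ 𝒞,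
      Tendsto (fun N : ℕ =>
        (∑ i ∈ Finset.range N, C.indicator (fun _ => (1 : ℝ)) (R (p.1, p.2 i))) / N)
        atTop (nhds ((P.map fun ω => R (p.1, ω)).real C)) := by
  refine (ae_ball_iff h𝒞).2 fun C hC => ?_
  have hCm := hmeas C hC
  have hval (ξ : Ξ) : (P.map fun ω => R (ξ, ω)).real C = P.real {ω | R (ξ, ω) ∈ C} := by
    rw [map_measureReal_apply (by fun_prop) hCm]
    rfl
  have hmv : Measurable fun ξ => P.real {ω | R (ξ, ω) ∈ C} :=
    (measurable_measure_prodMk_left (ν := P) (hR hCm)).ennreal_toReal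
  have hset : MeasurableSet {p : Ξ × (ℕ → Ω) | Tendsto (fun N : ℕ =>
        (∑ i ∈ Finset.range N, C.indicator (fun _ => (1 : ℝ)) (R (p.1, p.2 i))) / N)
        atTop (nhds ((P.map fun ω => R (p.1, ω)).real C))} := by
    simp_rw [hval]
    have hind : Measurable (C.indicator fun _ => (1 : ℝ)) := measurable_const.indicator hCm
    refine measurableSet_tendsto_fun (fun N => ?_) (hmv.comp measurable_fst)
    refine Measurable.div_const (Finset.measurable_sum _ fun i _ => ?_) _
    exact hind.comp (hR.comp (by fun_prop))
  -- By Fubini the independent parameter can be frozen, which leaves the strong law for a fixed set.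
  refine (Measure.ae_prod_iff_ae_ae hset).2 (ae_of_all _ fun ξ => ?_)
  simp only [hval]
  exact ae_tendsto_frequency P (C := {ω | R (ξ, ω) ∈ C}) ((hR.comp measurable_prodMk_left) hCm)

end Frequencies

/-! ### Determining classes and matching of generic points -/

theorem exists_countable_isPiSystem (E : Type*) [mE : MeasurableSpace E]
    [MeasurableSpace.CountablyGenerated E] :
    ∃ 𝒞 : Set (Set E), 𝒞.Countable ∧ IsPiSystem 𝒞 ∧ mE = MeasurableSpace.generateFrom 𝒞 := by
  obtain ⟨b, hb, hbE⟩ := MeasurableSpace.CountablyGenerated.isCountablyGenerated (α := E)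
  exact ⟨generateSetAlgebra b, countable_generateSetAlgebra hb,
    fun s hs t ht _ => isSetAlgebra_generateSetAlgebra.inter_mem hs ht,
    by rw [generateFrom_generateSetAlgebra_eq, ← hbE]⟩

/-- Two conull sets are matched by two measurable maps with the same law. -/
theorem exists_eq_of_map_eq {X Y Z : Type*} [MeasurableSpace X] [StandardBorelSpace X]
    [MeasurableSpace Y] [StandardBorelSpace Y] [MeasurableSpace Z] [TopologicalSpace Z]
    [PolishSpace Z] [BorelSpace Z]
    {μ : Measure X} [NeZero μ] {ν : Measure Y} {f : X → Z} {g : Y → Z}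
    (hf : Measurable f) (hg : Measurable g) (h : μ.map f = ν.map g)
    {p : X → Prop} {q : Y → Prop} (hp : ∀ᵐ x ∂μ, p x) (hq : ∀ᵐ y ∂ν, q y) :
    ∃ x y, p x ∧ q y ∧ f x = g y := by
  by_contra! hne
  obtain ⟨A, hA, hAm, hAp⟩ := exists_measurable_superset_of_null (ae_iff.1 hp)
  obtain ⟨B, hB, hBm, hBq⟩ := exists_measurable_superset_of_null (ae_iff.1 hq)
  have hdis : Disjoint (f '' Aᶜ) (g '' Bᶜ) := by
    rw [Set.disjoint_left]
    rintro _ ⟨x, hx, rfl⟩ ⟨y, hy, hxy⟩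
    exact hne x y (not_not.1 fun h => hx (hA h)) (not_not.1 fun h => hy (hB h)) hxy.symm
  -- The images of the two conull Borel sets are analytic; if they were disjoint, a Borel set `U`
  -- would separate them and have full measure for one law and measure zero for the other.
  obtain ⟨U, hU1, hU2, hU⟩ := (hAm.compl.analyticSet_image hf).measurablySeparable
    (hBm.compl.analyticSet_image hg) hdis
  have h1 : μ (f ⁻¹' Uᶜ) = 0 := measure_mono_null (fun x hx => by
    by_contra hxA
    exact hx (hU1 ⟨x, hxA, rfl⟩)) hAp
  have h2 : ν (g ⁻¹' U) = 0 := measure_mono_null (fun y hy => by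
    by_contra hyB
    exact Set.disjoint_left.1 hU2 ⟨y, hyB, rfl⟩ hy) hBq
  rw [← Measure.map_apply hg hU, ← h, Measure.map_apply hf hU] at h2
  refine NeZero.ne μ (Measure.measure_univ_eq_zero.1 ?_)
  rw [← Set.union_compl_self (f ⁻¹' U)]
  exact measure_union_null h2 h1

/-! ### Separation of points by values along a sequence -/

section Separation

variable {X Y : Type*} [MeasurableSpace X] [MeasurableSpace Y]

/-- The sections of an integrable function of two variables are, up to null sets, in the closure
in `L¹` of any sequence of sections that visits each set of a suitable countable family. -/
theorem exists_family_forall_ae_lintegral_lt {μ : Measure X} {ν : Measure Y} [SFinite μ] [SFinite ν]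
    [IsSeparable μ] {f : X × Y → ℝ} (hf : Measurable f) (hi : Integrable f (μ.prod ν)) :
    ∃ S : ℕ × ℕ → Set Y, (∀ i, MeasurableSet (S i)) ∧
      ∀ y : ℕ → Y, (∀ i, ν (S i) ≠ 0 → ∃ k, y k ∈ S i) →
        ∀ᵐ v ∂ν, ∀ ε : ℝ≥0∞, ε ≠ 0 → ∃ k, ∫⁻ x, ‖f (x, v) - f (x, y k)‖ₑ ∂μ < ε := by
  have : Fact ((1 : ℝ≥0∞) ≠ ∞) := ⟨ENNReal.one_ne_top⟩
  let u : ℕ → Lp ℝ 1 μ := TopologicalSpace.denseSeq _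
  have hu : DenseRange u := TopologicalSpace.denseRange_denseSeq _
  have hum (i : ℕ) : Measurable (u i : X → ℝ) := (Lp.stronglyMeasurable (u i)).measurable
  let d : ℕ → Y → ℝ≥0∞ := fun i v => ∫⁻ x, ‖f (x, v) - u i x‖ₑ ∂μ
  have hd (i : ℕ) : Measurable (d i) := by
    have : Measurable fun p : X × Y => ‖f p - u i p.1‖ₑ :=
      (hf.sub ((hum i).comp measurable_fst)).enorm
    exact this.lintegral_prod_left'
  -- `S (i, n)` consists of the points whose section is within `2⁻ⁿ` of the `i`-th element of a
  -- dense sequence in `L¹`.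
  refine ⟨fun i => {v | d i.1 v < (2⁻¹ : ℝ≥0∞) ^ i.2},
    fun i => measurableSet_lt (hd i.1) measurable_const, fun y hy => ?_⟩
  have hnull : ∀ᵐ v ∂ν, ∀ i : ℕ × ℕ, ν {v | d i.1 v < (2⁻¹ : ℝ≥0∞) ^ i.2} = 0 →
      v ∉ {v | d i.1 v < (2⁻¹ : ℝ≥0∞) ^ i.2} := by
    refine ae_all_iff.2 fun i => ?_
    by_cases h0 : ν {v | d i.1 v < (2⁻¹ : ℝ≥0∞) ^ i.2} = 0
    · filter_upwards [measure_eq_zero_iff_ae_notMem.1 h0] with v hv _ using hv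
    · exact ae_of_all _ fun v h => absurd h h0
  filter_upwards [hnull, hi.prod_left_ae] with v hv hvi ε hε
  obtain ⟨n, hn⟩ := ENNReal.exists_inv_two_pow_lt (ENNReal.half_pos hε).ne'
  obtain ⟨i, hiu⟩ := hu.exists_mem_open (Metric.isOpen_eball (x := hvi.toL1 _) (ε := (2⁻¹ : ℝ≥0∞) ^ n))
    ⟨_, Metric.mem_eball_self (pos_iff_ne_zero.2 (pow_ne_zero n (by simp)))⟩
  have hvS : d i v < (2⁻¹ : ℝ≥0∞) ^ n := by
    refine lt_of_eq_of_lt ?_ hiu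
    rw [edist_comm, Lp.edist_def, eLpNorm_one_eq_lintegral_enorm]
    refine lintegral_congr_ae ?_
    filter_upwards [hvi.coeFn_toL1] with x hx
    rw [Pi.sub_apply, hx]
  -- Since `v` avoids every null set of the family, the set containing it is nonnull and hence
  -- visited by `y`.
  obtain ⟨k, hk⟩ := hy (i, n) fun h0 => hv (i, n) h0 hvS
  refine ⟨k, ?_⟩
  have hk' : d i (y k) < (2⁻¹ : ℝ≥0∞) ^ n := hk
  calc ∫⁻ x, ‖f (x, v) - f (x, y k)‖ₑ ∂μ
      ≤ ∫⁻ x, ‖f (x, v) - u i x‖ₑ + ‖f (x, y k) - u i x‖ₑ ∂μ := by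
        refine lintegral_mono fun x => ?_
        calc ‖f (x, v) - f (x, y k)‖ₑ = ‖(f (x, v) - u i x) - (f (x, y k) - u i x)‖ₑ := by
              congr 1; ring
          _ ≤ _ := enorm_sub_le
    _ = d i v + d i (y k) := by
        refine lintegral_add_left (Measurable.enorm ?_) _
        exact (hf.comp measurable_prodMk_right).sub (hum i)
    _ < ε / 2 + ε / 2 := ENNReal.add_lt_add (hvS.trans hn) (hk'.trans hn)
    _ = ε := ENNReal.add_halves ε

/-- If the sections of `f` in the second variable are dense in `L¹` along a sequence `y`, then
the values of `f` along `y` determine the section of `f` in the first variable. -/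
theorem ae_section_eq_of_forall_eq {μ : Measure X} {ν : Measure Y} [SFinite μ] [IsFiniteMeasure ν]
    {f : X × Y → ℝ} (hf : Measurable f) {y : ℕ → Y}
    (hy : ∀ᵐ v ∂ν, ∀ ε : ℝ≥0∞, ε ≠ 0 → ∃ k, ∫⁻ x, ‖f (x, v) - f (x, y k)‖ₑ ∂μ < ε) :
    ∃ A : Set X, (∀ᵐ x ∂μ, x ∈ A) ∧ ∀ x ∈ A, ∀ x' ∈ A, (∀ k, f (x, y k) = f (x', y k)) →
      ∀ᵐ v ∂ν, f (x, v) = f (x', v) := by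
  classical
  let p : ℕ → Y → ℕ → Prop := fun j v k => ∫⁻ x, ‖f (x, v) - f (x, y k)‖ₑ ∂μ < (2⁻¹ : ℝ≥0∞) ^ j
  have hpm (j k : ℕ) : MeasurableSet {v | p j v k} := by
    refine measurableSet_lt ?_ measurable_const
    have : Measurable fun q : X × Y => ‖f q - f (q.1, y k)‖ₑ := by fun_prop
    exact this.lintegral_prod_left'
  have hex (j : ℕ) (v : Y) : ∃ k, p j v k ∨ ∀ l, ¬ p j v l := by
    by_cases h : ∃ k, p j v k
    · exact h.imp fun _ => Or.inl
    · exact ⟨0, Or.inr (not_exists.1 h)⟩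
  -- The first index with error below `2⁻ʲ`, a measurable choice. The alternative in `hex` only
  -- makes `Nat.find` total; by `hy` it does not occur for almost every `v`.
  let N : ℕ → Y → ℕ := fun j v => Nat.find (hex j v)
  have hN (j : ℕ) : Measurable (N j) := measurable_find (hex j) fun k => by
    have : {v | p j v k ∨ ∀ l, ¬ p j v l} = {v | p j v k} ∪ ⋂ l, {v | p j v l}ᶜ := by
      ext v; simp
    rw [this]
    exact (hpm j k).union (.iInter fun l => (hpm j l).compl)
  have hyN (j : ℕ) : Measurable fun v => y (N j v) := (measurable_from_nat (f := y)).comp (hN j)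
  have hterm (j : ℕ) : Measurable fun q : X × Y => ‖f q - f (q.1, y (N j q.2))‖ₑ := by
    have := hyN j
    fun_prop
  have hsum : Measurable fun q : X × Y => ∑' j, ‖f q - f (q.1, y (N j q.2))‖ₑ :=
    Measurable.tsum hterm
  have hmeas : MeasurableSet {q : X × Y | ∑' j, ‖f (q.1, q.2) - f (q.1, y (N j q.2))‖ₑ < ∞} :=
    measurableSet_lt hsum measurable_const
  -- The `L¹` errors are summable, so the chosen approximations converge pointwise a.e.; Fubini
  -- turns this into a statement about almost every `x`.
  have hfin : ∀ᵐ x ∂μ, ∀ᵐ v ∂ν, ∑' j, ‖f (x, v) - f (x, y (N j v))‖ₑ < ∞ := by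
    rw [Measure.ae_ae_comm hmeas]
    filter_upwards [hy] with v hv
    refine ae_lt_top (hsum.comp measurable_prodMk_right) (ne_of_lt ?_)
    calc ∫⁻ x, ∑' j, ‖f (x, v) - f (x, y (N j v))‖ₑ ∂μ
        = ∑' j, ∫⁻ x, ‖f (x, v) - f (x, y (N j v))‖ₑ ∂μ :=
          lintegral_tsum fun j => ((hterm j).comp measurable_prodMk_right).aemeasurable
      _ ≤ ∑' j : ℕ, (2⁻¹ : ℝ≥0∞) ^ j := by
          refine ENNReal.tsum_le_tsum fun j => ?_
          obtain ⟨k, hk⟩ := hv ((2⁻¹ : ℝ≥0∞) ^ j) (pow_ne_zero _ (by simp))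
          exact ((Nat.find_spec (hex j v)).resolve_right fun h => h k hk).le
      _ < ∞ := by
          rw [ENNReal.tsum_geometric]
          exact ENNReal.inv_lt_top.2 (tsub_pos_of_lt ENNReal.one_half_lt_one)
  refine ⟨{x | ∀ᵐ v ∂ν, ∑' j, ‖f (x, v) - f (x, y (N j v))‖ₑ < ∞}, hfin, fun x hx x' hx' h => ?_⟩
  have hlim {x : X} {v : Y} (h : ∑' j, ‖f (x, v) - f (x, y (N j v))‖ₑ < ∞) :
      Tendsto (fun j => f (x, y (N j v))) atTop (nhds (f (x, v))) := by
    rw [tendsto_iff_edist_tendsto_0]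
    have := ENNReal.tendsto_atTop_zero_of_tsum_ne_top h.ne
    refine this.congr fun j => ?_
    rw [edist_comm, edist_eq_enorm_sub]
  have hx1 : ∀ᵐ v ∂ν, ∑' j, ‖f (x, v) - f (x, y (N j v))‖ₑ < ∞ := hx
  have hx2 : ∀ᵐ v ∂ν, ∑' j, ‖f (x', v) - f (x', y (N j v))‖ₑ < ∞ := hx'
  filter_upwards [hx1, hx2] with v h1 h2
  refine tendsto_nhds_unique (hlim h1) ((hlim h2).congr fun j => (h _).symm)

/-- If the sections of `f` in the first variable are pairwise different, then the values of `f`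
along a sequence that visits each nonnull set of a suitable countable family
separate points mod 0. -/
theorem exists_family_injOn {μ : Measure X} {ν : Measure Y} [SFinite μ] [IsFiniteMeasure ν]
    [IsSeparable μ] {f : X × Y → ℝ} (hf : Measurable f) (hi : Integrable f (μ.prod ν))
    {A : Set X} (hA : ∀ᵐ x ∂μ, x ∈ A)
    (hsep : ∀ x ∈ A, ∀ x' ∈ A, (∀ᵐ v ∂ν, f (x, v) = f (x', v)) → x = x') :
    ∃ S : ℕ × ℕ → Set Y, (∀ i, MeasurableSet (S i)) ∧
      ∀ y : ℕ → Y, (∀ i, ν (S i) ≠ 0 → ∃ k, y k ∈ S i) →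
        ∃ A' : Set X, MeasurableSet A' ∧ (∀ᵐ x ∂μ, x ∈ A') ∧
          Set.InjOn (fun x k => f (x, y k)) A' := by
  obtain ⟨S, hS, h⟩ := exists_family_forall_ae_lintegral_lt hf hi
  refine ⟨S, hS, fun y hy => ?_⟩
  obtain ⟨B, hB, hBeq⟩ := ae_section_eq_of_forall_eq hf (h y hy)
  obtain ⟨N, hN, hNm, hN0⟩ := exists_measurable_superset_of_null (ae_iff.1 (hA.and hB))
  have hmem {x : X} (hx : x ∈ Nᶜ) : x ∈ A ∧ x ∈ B := not_not.1 fun h' => hx (hN h')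
  refine ⟨Nᶜ, hNm.compl, compl_mem_ae_iff.2 hN0, fun x hx x' hx' hxx => ?_⟩
  exact hsep x (hmem hx).1 x' (hmem hx').1
    (hBeq x (hmem hx).2 x' (hmem hx').2 fun k => congrFun hxx k)

/-- Lusin–Souslin: an injective Borel map on a Borel set of a standard space is a measurable
embedding, so its inverse extends measurably. -/
theorem exists_measurable_leftInvOn {E : Type*} [StandardBorelSpace X] [Nonempty X]
    [MeasurableSpace E] [MeasurableSpace.CountablySeparated E]
    {F : X → E} (hF : Measurable F) {A : Set X} (hA : MeasurableSet A) (hinj : Set.InjOn F A) :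
    ∃ G : E → X, Measurable G ∧ Set.LeftInvOn G F A := by
  have := hA.standardBorel
  have hemb : MeasurableEmbedding (fun a : A => F a) :=
    (hF.comp measurable_subtype_coe).measurableEmbedding
      fun a b h => Subtype.ext (hinj a.2 b.2 h)
  obtain ⟨G, hG, h⟩ := hemb.exists_measurable_extend measurable_subtype_coe fun _ => inferInstance
  exact ⟨G, hG, fun a ha => congrFun h ⟨a, ha⟩⟩

section Inverse

variable {E : Type*} [MeasurableSpace E] {μ : Measure X} {ν : Measure Y} {F₁ : X → E} {F₂ : Y → E}
  {G₁ : E → X} {G₂ : E → Y}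

theorem measurePreserving_leftInverse_comp (hF₁ : Measurable F₁) (hF₂ : Measurable F₂)
    (h : μ.map F₁ = ν.map F₂) (hG₂ : Measurable G₂) (h₂ : ∀ᵐ y ∂ν, G₂ (F₂ y) = y) :
    MeasurePreserving (G₂ ∘ F₁) μ ν :=
  ⟨hG₂.comp hF₁, by
    rw [← Measure.map_map hG₂ hF₁, h, Measure.map_map hG₂ hF₂]
    exact (Measure.map_congr h₂).trans Measure.map_id⟩

/-- The relation `F₂ (G₂ e) = e` holds almost everywhere for the law of `F₂`, which is also the law
of `F₁`; it can therefore be pulled back along `F₁`. -/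
theorem ae_leftInverse_comp [MeasurableEq E] (hF₁ : Measurable F₁) (hF₂ : Measurable F₂)
    (h : μ.map F₁ = ν.map F₂) (hG₂ : Measurable G₂) (h₁ : ∀ᵐ x ∂μ, G₁ (F₁ x) = x)
    (h₂ : ∀ᵐ y ∂ν, G₂ (F₂ y) = y) : ∀ᵐ x ∂μ, G₁ (F₂ (G₂ (F₁ x))) = x := by
  have hm : MeasurableSet {e : E | F₂ (G₂ e) = e} :=
    measurableSet_eq_fun (hF₂.comp hG₂) measurable_id
  have he : ∀ᵐ e ∂(ν.map F₂), F₂ (G₂ e) = e := by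
    rw [ae_map_iff hF₂.aemeasurable hm]
    filter_upwards [h₂] with y hy
    rw [hy]
  rw [← h, ae_map_iff hF₁.aemeasurable hm] at he
  filter_upwards [he, h₁] with x hx hx1
  rw [hx, hx1]

/-- Two maps with the same law that are one-to-one mod 0 differ by an isomorphism mod 0. -/
theorem isIsoMod0_of_map_eq [MeasurableEq E] (hF₁ : Measurable F₁) (hF₂ : Measurable F₂)
    (h : μ.map F₁ = ν.map F₂) (hG₁ : Measurable G₁) (hG₂ : Measurable G₂)
    (h₁ : ∀ᵐ x ∂μ, G₁ (F₁ x) = x) (h₂ : ∀ᵐ y ∂ν, G₂ (F₂ y) = y) :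
    IsIsoMod0 μ ν (G₂ ∘ F₁) :=
  ⟨measurePreserving_leftInverse_comp hF₁ hF₂ h hG₂ h₂, G₁ ∘ F₂,
    measurePreserving_leftInverse_comp hF₂ hF₁ h.symm hG₁ h₁,
    ae_leftInverse_comp hF₁ hF₂ h hG₂ h₁ h₂, ae_leftInverse_comp hF₂ hF₁ h.symm hG₁ h₂ h₁⟩

end Inverse

end Separation

/-! ### Reconstruction of the function from one matrix -/

/-- The values of `f` at the intersections of the row and the column of a point with the columns
and the rows of a sequence of points, and the value of `f` at the point. -/
def crossValues (f : I × I → ℝ) (q : (ℕ → I × I) × (I × I)) : (ℕ → ℝ) × (ℕ → ℝ) × ℝ :=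
  ((fun k => f (q.2.1, (q.1 k).2)), (fun k => f ((q.1 k).1, q.2.2)), f q.2)

theorem measurable_crossValues {f : I × I → ℝ} (hf : Measurable f) :
    Measurable (crossValues f) := by
  unfold crossValues
  fun_prop

/-- The sequence of points `ξ` separates the rows and the columns of `f` mod 0. -/
def Separates (f : I × I → ℝ) (ξ : ℕ → I × I) : Prop :=
  (∃ A : Set I, MeasurableSet A ∧ (∀ᵐ x, x ∈ A) ∧ Set.InjOn (fun x k => f (x, (ξ k).2)) A) ∧
  (∃ B : Set I, MeasurableSet B ∧ (∀ᵐ y, y ∈ B) ∧ Set.InjOn (fun y k => f ((ξ k).1, y)) B)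

theorem ae_separates {f : I × I → ℝ} (hf : Measurable f) (hi : Integrable f) (hp : IsPure f) :
    ∀ᵐ ξ ∂(Measure.infinitePi fun _ : ℕ => (volume : Measure I).prod volume), Separates f ξ := by
  obtain ⟨⟨A, hA, hAsep⟩, ⟨B, hB, hBsep⟩⟩ := hp
  obtain ⟨S, hS, hSinj⟩ := exists_family_injOn hf hi hA hAsep
  obtain ⟨S', hS', hSinj'⟩ := exists_family_injOn (f := f ∘ Prod.swap)
    (hf.comp measurable_swap) hi.swap hB hBsep
  have h1 : ∀ᵐ ξ ∂(Measure.infinitePi fun _ : ℕ => (volume : Measure I).prod volume),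
      ∀ i, volume (S i) ≠ 0 → ∃ k, (ξ k).2 ∈ S i := by
    refine ae_all_iff.2 fun i => ?_
    by_cases h0 : volume (S i) = 0
    · simp [h0]
    · filter_upwards [ae_exists_mem ((volume : Measure I).prod volume) (measurable_snd (hS i))
       
        (by rwa [(measurePreserving_snd (μ := (volume : Measure I))
          (ν := (volume : Measure I))).measure_preimage (hS i).nullMeasurableSet])] with ξ hξ _
        using hξ
  have h2 : ∀ᵐ ξ ∂(Measure.infinitePi fun _ : ℕ => (volume : Measure I).prod (volume : Measure I)),
      ∀ i, volume (S' i) ≠ 0 → ∃ k, (ξ k).1 ∈ S' i := by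
    refine ae_all_iff.2 fun i => ?_
    by_cases h0 : volume (S' i) = 0
    · simp [h0]
    · filter_upwards [ae_exists_mem ((volume : Measure I).prod volume) (measurable_fst (hS' i))
       
        (by rwa [(measurePreserving_fst (μ := (volume : Measure I))
          (ν := (volume : Measure I))).measure_preimage (hS' i).nullMeasurableSet])] with ξ hξ _
        using hξ
  filter_upwards [h1, h2] with ξ hξ1 hξ2
  exact ⟨hSinj _ hξ1, hSinj' _ hξ2⟩

/-- Two functions with the same law of the cross values at separating sequences
are isomorphic. -/
theorem isomorphic_of_map_crossValues_eq {f₁ f₂ : I × I → ℝ} (hf₁ : Measurable f₁)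
    (hf₂ : Measurable f₂) {ξ₁ ξ₂ : ℕ → I × I} (h₁ : Separates f₁ ξ₁) (h₂ : Separates f₂ ξ₂)
    (h : (volume : Measure (I × I)).map (fun q => crossValues f₁ (ξ₁, q)) =
      (volume : Measure (I × I)).map fun q => crossValues f₂ (ξ₂, q)) :
    Isomorphic f₁ f₂ := by
  obtain ⟨⟨A₁, hA₁, hA₁', hiA₁⟩, ⟨B₁, hB₁, hB₁', hiB₁⟩⟩ := h₁
  obtain ⟨⟨A₂, hA₂, hA₂', hiA₂⟩, ⟨B₂, hB₂, hB₂', hiB₂⟩⟩ := h₂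
  have hrow {f : I × I → ℝ} (hf : Measurable f) (ξ : ℕ → I × I) :
      Measurable fun x k => f (x, (ξ k).2) := by fun_prop
  have hcol {f : I × I → ℝ} (hf : Measurable f) (ξ : ℕ → I × I) :
      Measurable fun y k => f ((ξ k).1, y) := by fun_prop
  have hcross {f : I × I → ℝ} (hf : Measurable f) (ξ : ℕ → I × I) :
      Measurable fun q => crossValues f (ξ, q) := (measurable_crossValues hf).comp (by fun_prop)
  obtain ⟨G₁, hG₁, hGA₁⟩ := exists_measurable_leftInvOn (hrow hf₁ ξ₁) hA₁ hiA₁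
  obtain ⟨G₂, hG₂, hGA₂⟩ := exists_measurable_leftInvOn (hrow hf₂ ξ₂) hA₂ hiA₂
  obtain ⟨H₁, hH₁, hHB₁⟩ := exists_measurable_leftInvOn (hcol hf₁ ξ₁) hB₁ hiB₁
  obtain ⟨H₂, hH₂, hHB₂⟩ := exists_measurable_leftInvOn (hcol hf₂ ξ₂) hB₂ hiB₂
  have mapRow {f : I × I → ℝ} (hf : Measurable f) (ξ : ℕ → I × I) :
      ((volume : Measure (I × I)).map fun q => crossValues f (ξ, q)).map Prod.fst =
        (volume : Measure I).map fun x k => f (x, (ξ k).2) := by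
    rw [Measure.map_map measurable_fst (hcross hf ξ),
      ← (measurePreserving_fst (μ := (volume : Measure I)) (ν := (volume : Measure I))).map_eq,
      Measure.map_map (hrow hf ξ) measurable_fst]
    rfl
  have mapCol {f : I × I → ℝ} (hf : Measurable f) (ξ : ℕ → I × I) :
      ((volume : Measure (I × I)).map fun q => crossValues f (ξ, q)).map (fun c => c.2.1) =
        (volume : Measure I).map fun y k => f ((ξ k).1, y) := by
    rw [Measure.map_map (by fun_prop) (hcross hf ξ),
      ← (measurePreserving_snd (μ := (volume : Measure I)) (ν := (volume : Measure I))).map_eq,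
      Measure.map_map (hcol hf ξ) measurable_snd]
    rfl
  have hG₂' : ∀ᵐ x, G₂ (fun k => f₂ (x, (ξ₂ k).2)) = x := hA₂'.mono fun x hx => hGA₂ hx
  have hH₂' : ∀ᵐ y, H₂ (fun k => f₂ ((ξ₂ k).1, y)) = y := hB₂'.mono fun y hy => hHB₂ hy
  refine ⟨_, _,
    isIsoMod0_of_map_eq (hrow hf₁ ξ₁) (hrow hf₂ ξ₂) (by rw [← mapRow hf₁, h, mapRow hf₂])
      hG₁ hG₂ (hA₁'.mono fun x hx => hGA₁ hx) hG₂',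
    isIsoMod0_of_map_eq (hcol hf₁ ξ₁) (hcol hf₂ ξ₂) (by rw [← mapCol hf₁, h, mapCol hf₂])
      hH₁ hH₂ (hB₁'.mono fun y hy => hHB₁ hy) hH₂', ?_⟩
  have hm : MeasurableSet {c : (ℕ → ℝ) × (ℕ → ℝ) × ℝ | f₂ (G₂ c.1, H₂ c.2.1) = c.2.2} :=
    measurableSet_eq_fun (by fun_prop) (by fun_prop)
  -- That the third coordinate is `f₂` of the decoded first two is a property of the law alone, so
  -- it transfers to the cross values of `f₁`.
  have hgraph : ∀ᵐ c ∂((volume : Measure (I × I)).map fun q => crossValues f₂ (ξ₂, q)),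
      f₂ (G₂ c.1, H₂ c.2.1) = c.2.2 := by
    rw [ae_map_iff (hcross hf₂ ξ₂).aemeasurable hm]
    filter_upwards [measurePreserving_fst.quasiMeasurePreserving.ae hG₂',
      measurePreserving_snd.quasiMeasurePreserving.ae hH₂'] with q h1 h2
    simp only [crossValues]
    rw [h1, h2]
  rw [← h, ae_map_iff (hcross hf₁ ξ₁).aemeasurable hm] at hgraph
  exact hgraph

theorem isomorphic_of_matrixDistribution_eq {f₁ f₂ : I × I → ℝ} (hf₁ : Measurable f₁)
    (hf₂ : Measurable f₂) (hi₁ : Integrable f₁) (hi₂ : Integrable f₂) (hp₁ : IsPure f₁)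
    (hp₂ : IsPure f₂) (h : matrixDistribution f₁ = matrixDistribution f₂) :
    Isomorphic f₁ f₂ := by
  obtain ⟨𝒞, h𝒞, hpi, hgen⟩ := exists_countable_isPiSystem ((ℕ → ℝ) × (ℕ → ℝ) × ℝ)
  have hmeas : ∀ C ∈ 𝒞, MeasurableSet C := fun C hC => by
    rw [hgen]
    exact MeasurableSpace.measurableSet_generateFrom hC
  have hgood {f : I × I → ℝ} (hf : Measurable f) (hi : Integrable f) (hp : IsPure f) :=
    measurePreserving_gridSplit.quasiMeasurePreserving.ae
      ((Measure.quasiMeasurePreserving_fst.ae (ae_separates hf hi hp)).and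
        (ae_tendsto_frequency_map (Measure.infinitePi fun _ : ℕ => (volume : Measure I).prod volume)
          ((volume : Measure I).prod volume) (measurable_crossValues hf) h𝒞 hmeas))
  obtain ⟨g₁, g₂, ⟨hs₁, ht₁⟩, ⟨hs₂, ht₂⟩, hg⟩ := exists_eq_of_map_eq (measurable_gridMatrix hf₁)
    (measurable_gridMatrix hf₂) h (hgood hf₁ hi₁ hp₁) (hgood hf₂ hi₂ hp₂)
  have hM (n m : ℤ) : f₁ (g₁.1 n, g₁.2 m) = f₂ (g₂.1 n, g₂.2 m) := congrFun (congrFun hg n) m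
  refine isomorphic_of_map_crossValues_eq hf₁ hf₂ hs₁ hs₂ ?_
  have hcross {f : I × I → ℝ} (hf : Measurable f) (ξ : ℕ → I × I) :
      Measurable fun q => crossValues f (ξ, q) := (measurable_crossValues hf).comp (by fun_prop)
  have := Measure.isProbabilityMeasure_map (μ := (volume : Measure (I × I)))
    (hcross hf₁ fun k : ℕ => (g₁.1 (Int.negSucc k), g₁.2 (Int.negSucc k))).aemeasurable
  have := Measure.isProbabilityMeasure_map (μ := (volume : Measure (I × I)))
    (hcross hf₂ fun k : ℕ => (g₂.1 (Int.negSucc k), g₂.2 (Int.negSucc k))).aemeasurable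
  refine ext_of_generate_finite 𝒞 hgen hpi (fun C hC => ?_) (by simp)
  rw [← measureReal_eq_measureReal_iff]
  refine tendsto_nhds_unique (ht₁ C hC) ?_
  have h2 := ht₂ C hC
  -- All the cross values involved are matrix entries, so both grids have the same empirical
  -- frequencies.
  simp only [crossValues, ← hM] at h2
  exact h2

/-! ### Changes on null sets, invariance and the easy implications -/

theorem IsPure.congr {f g : I × I → ℝ} (hf : IsPure f) (h : f =ᵐ[volume] g) : IsPure g := by
  obtain ⟨⟨A, hA, hAsep⟩, ⟨B, hB, hBsep⟩⟩ := hf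
  have hrow : ∀ᵐ x : I, ∀ᵐ y : I, f (x, y) = g (x, y) := Measure.ae_ae_of_ae_prod h
  have hcol : ∀ᵐ y : I, ∀ᵐ x : I, f (x, y) = g (x, y) :=
    Measure.ae_ae_of_ae_prod
      (Measure.measurePreserving_swap.quasiMeasurePreserving.ae h)
  refine ⟨⟨_, hA.and hrow, fun x hx x' hx' hxx => hAsep x hx.1 x' hx'.1 ?_⟩,
    ⟨_, hB.and hcol, fun y hy y' hy' hyy => hBsep y hy.1 y' hy'.1 ?_⟩⟩
  · filter_upwards [hx.2, hx'.2, hxx] with y h1 h2 h3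
    rw [h1, h2, h3]
  · filter_upwards [hy.2, hy'.2, hyy] with x h1 h2 h3
    rw [h1, h2, h3]

theorem Isomorphic.congr {f₁ f₂ g₁ g₂ : I × I → ℝ} (h : Isomorphic f₁ f₂)
    (h₁ : f₁ =ᵐ[volume] g₁) (h₂ : f₂ =ᵐ[volume] g₂) : Isomorphic g₁ g₂ := by
  obtain ⟨T₁, T₂, hT₁, hT₂, hT⟩ := h
  refine ⟨T₁, T₂, hT₁, hT₂, ?_⟩
  filter_upwards [hT, h₁, (hT₁.1.prod hT₂.1).quasiMeasurePreserving.ae h₂] with p hp hp1 hp2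
  exact hp2.symm.trans (hp.trans hp1)

/-- Without this, `Measure.map` in the definition of the matrix distribution could take its default
value zero. -/
theorem aemeasurable_gridMatrix {f : I × I → ℝ} (hf : AEMeasurable f) :
    AEMeasurable (gridMatrix f) gridMeasure :=
  ⟨_, measurable_gridMatrix hf.measurable_mk, gridMatrix_ae_eq hf.ae_eq_mk⟩

theorem isProbabilityMeasure_matrixDistribution {f : I × I → ℝ} (hf : AEMeasurable f) :
    IsProbabilityMeasure (matrixDistribution f) :=
  Measure.isProbabilityMeasure_map (aemeasurable_gridMatrix hf)

theorem measurePreserving_translateMat {f : I × I → ℝ} (hf : AEMeasurable f) (k : ℤ × ℤ) :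
    MeasurePreserving (translateMat k) (matrixDistribution f) (matrixDistribution f) := by
  have hm : Measurable (translateMat k) := by unfold translateMat; fun_prop
  refine ⟨hm, ?_⟩
  rw [matrixDistribution_congr hf.ae_eq_mk, matrixDistribution]
  have hg := measurable_gridMatrix hf.measurable_mk
  rw [Measure.map_map hm hg]
  conv_rhs => rw [← (measurePreserving_gridTranslate k).map_eq]
  rw [Measure.map_map hg (measurePreserving_gridTranslate k).measurable]
  rfl

theorem Isomorphic.matrixDistribution_eq {f₁ f₂ : I × I → ℝ} (hf₂ : AEMeasurable f₂)
    (h : Isomorphic f₁ f₂) : matrixDistribution f₁ = matrixDistribution f₂ := by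
  obtain ⟨T₁, T₂, hT₁, hT₂, hT⟩ := h
  have hG := measurePreserving_gridMap hT₁.1 hT₂.1
  rw [matrixDistribution_congr (f := f₁) (g := fun p => f₂ (T₁ p.1, T₂ p.2))
    (hT.mono fun p hp => hp.symm)]
  unfold matrixDistribution
  conv_rhs => rw [← hG.map_eq]
  rw [AEMeasurable.map_map_of_aemeasurable (by
    rw [hG.map_eq]; exact aemeasurable_gridMatrix hf₂) hG.aemeasurable]
  rfl

/-- An isomorphism of translation invariant measures that respects the entry at the origin is
the identity almost everywhere. -/
theorem TranslationIsomorphic.eq {D₁ D₂ : Measure Mat}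
    (hD : ∀ k, MeasurePreserving (translateMat k) D₁ D₁) (h : TranslationIsomorphic D₁ D₂) :
    D₁ = D₂ := by
  obtain ⟨Φ, hΦ, hcomm, h0⟩ := h
  have hae : ∀ᵐ M ∂D₁, ∀ k : ℤ × ℤ, Φ (translateMat k M) = translateMat k (Φ M) ∧
      Φ (translateMat k M) 0 0 = translateMat k M 0 0 :=
    ae_all_iff.2 fun k => (hcomm k).and ((hD k).quasiMeasurePreserving.ae h0)
  have hid : Φ =ᵐ[D₁] id := by
    filter_upwards [hae] with M hM
    funext n m
    obtain ⟨h1, h2⟩ := hM (n, m)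
    rw [h1] at h2
    simpa [translateMat] using h2
  rw [← hΦ.1.map_eq, Measure.map_congr hid, Measure.map_id]

theorem TranslationIsomorphic.refl (D : Measure Mat) : TranslationIsomorphic D D :=
  ⟨id, ⟨.id D, id, .id D, ae_of_all _ fun _ => rfl, ae_of_all _ fun _ => rfl⟩,
    fun _ => ae_of_all _ fun _ => rfl, ae_of_all _ fun _ => rfl⟩

theorem isomorphic_iff_matrixDistribution_eq {f₁ f₂ : I × I → ℝ} (hi₁ : Integrable f₁)
    (hi₂ : Integrable f₂) (hp₁ : IsPure f₁) (hp₂ : IsPure f₂) :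
    Isomorphic f₁ f₂ ↔ matrixDistribution f₁ = matrixDistribution f₂ := by
  refine ⟨fun h => h.matrixDistribution_eq hi₂.aemeasurable, fun h => ?_⟩
  -- The reconstruction evaluates individual sections, so it is applied to Borel representatives;
  -- purity, isomorphism and the matrix distribution depend only on a.e. classes.
  have e₁ := hi₁.aemeasurable.ae_eq_mk
  have e₂ := hi₂.aemeasurable.ae_eq_mk
  exact (isomorphic_of_matrixDistribution_eq hi₁.aemeasurable.measurable_mk
    hi₂.aemeasurable.measurable_mk (hi₁.congr e₁) (hi₂.congr e₂) (hp₁.congr e₁) (hp₂.congr e₂)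
    (by rw [← matrixDistribution_congr e₁, h, matrixDistribution_congr e₂])).congr e₁.symm e₂.symm

end MatrixDistribution

theorem lemma3 :
    (∀ f : I × I → ℝ, Integrable f → MatrixDistribution.IsPure f →
      IsProbabilityMeasure (MatrixDistribution.matrixDistribution f) ∧
      ∀ k : ℤ × ℤ, MeasurePreserving (MatrixDistribution.translateMat k)
        (MatrixDistribution.matrixDistribution f) (MatrixDistribution.matrixDistribution f)) ∧
    (∀ f₁ f₂ : I × I → ℝ, Integrable f₁ → Integrable f₂ →
      MatrixDistribution.IsPure f₁ → MatrixDistribution.IsPure f₂ →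
      (MatrixDistribution.Isomorphic f₁ f₂ ↔
        MatrixDistribution.matrixDistribution f₁ = MatrixDistribution.matrixDistribution f₂) ∧
      (MatrixDistribution.Isomorphic f₁ f₂ ↔
        MatrixDistribution.TranslationIsomorphic (MatrixDistribution.matrixDistribution f₁)
          (MatrixDistribution.matrixDistribution f₂))) := by
  refine ⟨fun f hi _ => ⟨MatrixDistribution.isProbabilityMeasure_matrixDistribution hi.aemeasurable,
    MatrixDistribution.measurePreserving_translateMat hi.aemeasurable⟩,
    fun f₁ f₂ hi₁ hi₂ hp₁ hp₂ => ?_⟩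
  have h := MatrixDistribution.isomorphic_iff_matrixDistribution_eq hi₁ hi₂ hp₁ hp₂
  refine ⟨h, h.trans ⟨fun e => e ▸ .refl _, fun e => e.eq
    (MatrixDistribution.measurePreserving_translateMat hi₁.aemeasurable)⟩⟩
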